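/- **Model.** Let $n\ge 1$, and let $G$ be a simple undirected graph with node set $[n]$. Which node of the graph gets which name is part of the adversary's choice of $G$. In the *online-LOCAL model with locality $T$*, the nodes are presented in an order $v_1,\dots,v_n$. When $v_i$ arrives, the algorithm sees the sequence $v_1,\dots,v_i$, the subgraph $G_i=G\big[\bigcup_{j\le i}\{u:\operatorname{dist}_G(u,v_j)\le T\}\big]$ induced by the radius-$T$ neighborhoods of the nodes presented so far, and its own previous outputs, and it must irrevocably choose the output of $v_i$. The algorithm knows $n$ and has unbounded memory and computational power. In the *randomized online-LOCAL model (oblivious adversary)* the algorithm also has access to random bits, and the graph and the order are fixed before any random bits are drawn; equivalently, a randomized algorithm for $n$-node graphs is a probability distribution over deterministic ones. A randomized algorithm *3-colors* a family of $n$-node graphs with locality $T$ if, for every $G$ in the family and every order, its output is a proper coloring of $G$ with 3 colors, with failure probability at most $1/n$. **Theorem.** 1. Any randomized online-LOCAL algorithm that 3-colors $\sqrt n\times\sqrt n$ grids has locality $\Omega(\log n)$. That is, there are a constant $c>0$ and an $m_0$ such that for all $m\ge m_0$, with $n=m^2$, every randomized online-LOCAL algorithm with locality $T$ that 3-colors the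 $m\times m$ grids (with arbitrary node names from $[n]$) satisfies $T\ge c\log n$. 2. Consequently, 3-coloring bipartite graphs is not possible with locality $o(\log n)$ in the randomized online-LOCAL model. That is, if $T:\mathbb N\to\mathbb N$ satisfies $T(n)=o(\log n)$, then there is no family $(\mathcal A_n)_n$ of randomized online-LOCAL algorithms such that for all sufficiently large $n$ the algorithm $\mathcal A_n$ 3-colors all bipartite $n$-node graphs with locality $T(n)$. -/

import Mathlib

/-!
The randomized online-LOCAL model (oblivious adversary) for graph colouring.

The node set of an `n`-node graph is `Fin n` and is known to the algorithm in advance; which node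
of the abstract graph carries which name is part of the (adversarial) choice of the input graph.
-/

namespace OnlineLocal

/-- The radius-`T` neighbourhood of the node `u` in `G` (distances are `⊤` between different
components). -/
def nbhd {V : Type*} (G : SimpleGraph V) (T : ℕ) (u : V) : Set V :=
  {v | G.edist u v ≤ (T : ℕ∞)}

/-- The subgraph of `G` induced by `S`, as a graph on the ambient node set without any edges
outside of `S`. -/
def restrict {V : Type*} (G : SimpleGraph V) (S : Set V) : SimpleGraph V where
  Adj u v := G.Adj u v ∧ u ∈ S ∧ v ∈ S
  symm := ⟨fun _ _ h => ⟨h.1.symm, h.2.2, h.2.1⟩⟩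
  loopless := ⟨fun _ h => G.irrefl h.1⟩

/-- Everything the algorithm knows when it has to label the node that arrives at time `i`
(times are `0, 1, …, n - 1`). -/
structure View (n : ℕ) (C : Type*) (i : Fin n) where
  /-- the nodes presented so far, in order; the last one is the node to be labelled now -/
  processed : Fin (i.val + 1) → Fin n
  /-- the union of the radius-`T` neighbourhoods of the presented nodes -/
  revealed : Set (Fin n)
  /-- the subgraph of the input graph induced by the revealed nodes -/
  graph : SimpleGraph (Fin n)
  /-- the labels given to the previously presented nodes, in order -/
  outputs : Fin i.val → C

/-- A deterministic online algorithm for `n`-node graphs with output labels in `C`. It is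
computationally unbounded and has a global memory: each label is an arbitrary function of all the
information obtained so far. -/
abbrev DetAlgorithm (n : ℕ) (C : Type*) := (i : Fin n) → View n C i → C

/-- The set of nodes revealed up to and including time `i`, if the nodes are presented in the
order `σ 0, σ 1, …` with visibility radius `T`. -/
def revealedAt {n : ℕ} (G : SimpleGraph (Fin n)) (T : ℕ) (σ : Equiv.Perm (Fin n)) (i : Fin n) :
    Set (Fin n) :=
  ⋃ j ∈ Set.Iic i, nbhd G T (σ j)

/-- The label that the algorithm gives to the node `σ i`, presented at time `i`, when it is run
with locality `T` on the graph `G` and the processing order `σ`. -/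
def labelAt {n : ℕ} {C : Type*} (A : DetAlgorithm n C) (G : SimpleGraph (Fin n)) (T : ℕ)
    (σ : Equiv.Perm (Fin n)) (i : Fin n) : C :=
  A i
    { processed := fun j => σ ⟨j.val, lt_of_le_of_lt (Nat.lt_succ_iff.mp j.isLt) i.isLt⟩
      revealed := revealedAt G T σ i
      graph := restrict G (revealedAt G T σ i)
      outputs := fun j => labelAt A G T σ ⟨j.val, j.isLt.trans i.isLt⟩ }
termination_by i.val
decreasing_by exact j.isLt

/-- The labelling of the nodes that the run of the algorithm produces. -/
def output {n : ℕ} {C : Type*} (A : DetAlgorithm n C) (G : SimpleGraph (Fin n)) (T : ℕ)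
    (σ : Equiv.Perm (Fin n)) (v : Fin n) : C :=
  labelAt A G T σ (σ.symm v)

/-- A labelling is a proper colouring if adjacent nodes have different labels. -/
def IsProper {V C : Type*} (G : SimpleGraph V) (c : V → C) : Prop :=
  ∀ u v, G.Adj u v → c u ≠ c v

/-- A randomized online algorithm for `n`-node graphs: a probability distribution over
deterministic ones (all random bits are drawn up front, independently of the input; for finite `C`
there are only finitely many deterministic algorithms for a given `n`, so that a discrete
distribution is no restriction). -/
abbrev RandAlgorithm (n : ℕ) (C : Type*) := PMF (DetAlgorithm n C)

/-- With locality `T`, the randomized algorithm `μ` properly colours every graph of the family `F`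
of `n`-node graphs with colours from `C`: for each graph and each processing order, both fixed
before the random bits are drawn, the failure probability is at most `1 / n`. -/
def Colors {n : ℕ} {C : Type*} (F : Set (SimpleGraph (Fin n))) (T : ℕ)
    (μ : RandAlgorithm n C) : Prop :=
  ∀ G ∈ F, ∀ σ : Equiv.Perm (Fin n),
    μ.toOuterMeasure {A | ¬ IsProper G (output A G T σ)} ≤ 1 / (n : ENNReal)

/-- The graphs with node set `Fin n` that are `m × m` grids for some `m` (so `n = m ^ 2`), with
arbitrarily named nodes. -/
def squareGrids (n : ℕ) : Set (SimpleGraph (Fin n)) :=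
  {G | ∃ m : ℕ, Nonempty
    (G ≃g (SimpleGraph.pathGraph m).boxProd (SimpleGraph.pathGraph m))}

/-- The bipartite graphs with node set `Fin n`. -/
def bipartiteGraphs (n : ℕ) : Set (SimpleGraph (Fin n)) :=
  {G | G.IsBipartite}

end OnlineLocal


/-!
A 3-colouring gives every path a height that changes by `±1` along each edge, by `+1` from colour
`a` to colour `a + 1`. The height is constant around each 4-cycle, so the increments of two parallel
row segments at distance `d` differ by at most `2 * d`, and it has the parity of the position.

An oblivious adversary uses two rows at distance `2 * T + 3`, whose neighbourhoods are disjoint, and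
a binary hierarchy of tiles in each. At every level it has the algorithm colour the middle of all
tiles and then either reflects every second tile, up to a margin, or does not; one bit per level is
all it ever chooses. Two neighbouring tiles that attain the same spread of heights cannot both be
extremal in their union for either value of the bit, because the reflection changes the parity of
their distance. So the sum of `2 ^ (-spread)` over all tiles shrinks by `3 / 8` per level for one of
the bits, against a factor `1 / 2` for constant spread, and `3 * r` levels force a spread of `r` in
the first row. Finally the first row is moved over the second one, directly or with one of them
reflected. The increment of the second row would have to be close to that of the first and to its
negative, which is impossible for `r = 4 * T + 7`.

All choices together are fewer than `n` inputs, and each deterministic algorithm fails on one of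
them, so by the union bound a randomized algorithm fails on one of them with probability more than
`1 / n`.
-/

namespace OnlineLocal

/-! ### Locality -/

section Locality

variable {V : Type*} {G G' : SimpleGraph V} {T : ℕ} {u v : V}

theorem mem_nbhd_zero : v ∈ nbhd G 0 u ↔ u = v := by
  simp [nbhd, eq_comm (a := v)]

theorem nbhd_subset_succ : nbhd G T u ⊆ nbhd G (T + 1) u := fun _ hv =>
  le_trans (show G.edist _ _ ≤ _ from hv) (by exact_mod_cast T.le_succ)

theorem mem_nbhd_succ :
    v ∈ nbhd G (T + 1) u ↔ v ∈ nbhd G T u ∨ ∃ w ∈ nbhd G T u, G.Adj w v := by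
  constructor
  · intro h
    rw [nbhd, Set.mem_ofPred_eq, SimpleGraph.edist_comm] at h
    obtain ⟨p, hp⟩ := SimpleGraph.exists_walk_of_edist_ne_top
      (ne_top_of_le_ne_top (ENat.natCast_ne_top _) h)
    rw [← hp] at h
    cases p with
    | nil => exact Or.inl (by simp [nbhd])
    | @cons _ w _ hadj q =>
      refine Or.inr ⟨w, ?_, hadj.symm⟩
      have hq : q.length + 1 ≤ T + 1 := by exact_mod_cast h
      rw [nbhd, Set.mem_ofPred_eq, SimpleGraph.edist_comm]
      exact (SimpleGraph.edist_le q).trans (by exact_mod_cast Nat.le_of_succ_le_succ hq)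
  · rintro (h | ⟨w, hw, hadj⟩)
    · exact nbhd_subset_succ h
    · calc G.edist u v ≤ G.edist u w + G.edist w v := SimpleGraph.edist_triangle
        _ ≤ T + 1 := add_le_add hw (SimpleGraph.edist_eq_one_iff_adj.2 hadj).le
        _ = ((T + 1 : ℕ) : ℕ∞) := by push_cast; rfl

theorem nbhd_restrict {R : Set V} (h : nbhd G T u ⊆ R) :
    nbhd (restrict G R) T u = nbhd G T u := by
  induction T with
  | zero => ext v; rw [mem_nbhd_zero, mem_nbhd_zero]
  | succ T ih =>
    have ih := ih (nbhd_subset_succ.trans h)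
    ext v
    rw [mem_nbhd_succ, mem_nbhd_succ, ih]
    refine or_congr_right (exists_congr fun w => and_congr_right fun hw => ?_)
    exact ⟨And.left, fun hadj => ⟨hadj, h (nbhd_subset_succ hw),
      h (mem_nbhd_succ.2 (Or.inr ⟨w, hw, hadj⟩))⟩⟩

/-- The graphs `G` and `G'` have the same radius-`T` neighbourhood of `u`, and all edges with an
end in it agree. This is what makes them indistinguishable for an algorithm with locality `T` that
is presented `u`, whatever else has been revealed. -/
structure AgreeNear (G G' : SimpleGraph V) (T : ℕ) (u : V) : Prop where
  nbhd_eq : nbhd G T u = nbhd G' T u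
  adj_iff : ∀ w ∈ nbhd G T u, ∀ v, G.Adj w v ↔ G'.Adj w v

theorem agreeNear_of_restrict_eq {R : Set V} (hG : nbhd G (T + 1) u ⊆ R)
    (hG' : nbhd G' (T + 1) u ⊆ R) (h : restrict G R = restrict G' R) : AgreeNear G G' T u := by
  have hnbhd : nbhd G T u = nbhd G' T u := by
    rw [← nbhd_restrict (nbhd_subset_succ.trans hG), h,
      nbhd_restrict (nbhd_subset_succ.trans hG')]
  have mem_of_adj {H : SimpleGraph V} (hH : nbhd H (T + 1) u ⊆ R) {w v : V}
      (hw : w ∈ nbhd H T u) (hadj : H.Adj w v) : (restrict H R).Adj w v :=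
    ⟨hadj, hH (nbhd_subset_succ hw), hH (mem_nbhd_succ.2 (Or.inr ⟨w, hw, hadj⟩))⟩
  refine ⟨hnbhd, fun w hw v => ⟨fun hadj => ?_, fun hadj => ?_⟩⟩
  · exact (h ▸ mem_of_adj hG hw hadj : (restrict G' R).Adj w v).1
  · exact (h ▸ mem_of_adj hG' (hnbhd ▸ hw) hadj : (restrict G R).Adj w v).1

end Locality

section OnlineAlgorithm

variable {n : ℕ} {C : Type*} {G G' : SimpleGraph (Fin n)} {T : ℕ} {σ : Equiv.Perm (Fin n)}
  {U : Set (Fin n)}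

theorem restrict_revealedAt_congr {i : Fin n} (h : ∀ j ≤ i, AgreeNear G G' T (σ j)) :
    revealedAt G T σ i = revealedAt G' T σ i ∧
      restrict G (revealedAt G T σ i) = restrict G' (revealedAt G' T σ i) := by
  have hrev : revealedAt G T σ i = revealedAt G' T σ i :=
    Set.iUnion₂_congr fun j hj => (h j hj).nbhd_eq
  refine ⟨hrev, ?_⟩
  rw [← hrev]
  ext w v
  refine and_congr_left fun ⟨hw, _⟩ => ?_
  simp only [revealedAt, Set.mem_iUnion] at hw
  obtain ⟨j, hj, hw⟩ := hw
  exact (h j hj).adj_iff w hw v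

theorem labelAt_congr (A : DetAlgorithm n C) (hU : IsLowerSet (σ ⁻¹' U))
    (h : ∀ u ∈ U, AgreeNear G G' T u) (i : Fin n) (hi : σ i ∈ U) :
    labelAt A G T σ i = labelAt A G' T σ i := by
  induction i using WellFoundedLT.induction with
  | ind i ih =>
    obtain ⟨hrev, hgraph⟩ := restrict_revealedAt_congr fun j hj => h (σ j) (hU hj hi)
    have hout : (fun j : Fin i.val => labelAt A G T σ ⟨j.val, j.isLt.trans i.isLt⟩) =
        fun j : Fin i.val => labelAt A G' T σ ⟨j.val, j.isLt.trans i.isLt⟩ :=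
      funext fun j => ih _ (Fin.lt_def.2 j.isLt) (hU (Fin.le_def.2 j.isLt.le) hi)
    rw [labelAt, labelAt, hgraph, hrev, hout]

theorem output_congr (A : DetAlgorithm n C) (hU : IsLowerSet (σ ⁻¹' U))
    (h : ∀ u ∈ U, AgreeNear G G' T u) {u : Fin n} (hu : u ∈ U) :
    output A G T σ u = output A G' T σ u :=
  labelAt_congr A hU h _ (by simpa using hu)

theorem exists_perm_isLowerSet {U : ℕ → Set (Fin n)} (hU : Monotone U) :
    ∃ σ : Equiv.Perm (Fin n), ∀ j, IsLowerSet (σ ⁻¹' U j) := by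
  let stage : Fin n → ℕ∞ := fun u => ⨅ j ∈ {j | u ∈ U j}, (j : ℕ∞)
  have mem_iff (j : ℕ) (u : Fin n) : u ∈ U j ↔ stage u ≤ j := by
    refine ⟨fun hu => iInf₂_le j hu, fun hu => ?_⟩
    by_contra hj
    have hlt : ((j + 1 : ℕ) : ℕ∞) ≤ stage u := le_iInf₂ fun i hi => by
      by_contra! hij
      exact hj (hU (Nat.lt_succ_iff.1 (by exact_mod_cast hij)) hi)
    exact Nat.not_succ_le_self j (by exact_mod_cast hlt.trans hu)
  refine ⟨Tuple.sort stage, fun j a b hba ha => ?_⟩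
  rw [Set.mem_preimage, mem_iff] at ha ⊢
  exact (Tuple.monotone_sort stage hba).trans ha

end OnlineAlgorithm

/-! ### Grids -/

section Grid

/-- The infinite square grid; the points of the plane are written as (row, column). -/
def planeGrid : SimpleGraph (ℤ × ℤ) where
  Adj p q := |p.1 - q.1| + |p.2 - q.2| = 1
  symm := ⟨fun p q h => by rwa [abs_sub_comm q.1, abs_sub_comm q.2]⟩
  loopless := ⟨fun p h => by simp at h⟩

/-- The points of the `m × m` grid. -/
def square (m : ℕ) : Set (ℤ × ℤ) := Set.Ico 0 (m : ℤ) ×ˢ Set.Ico 0 (m : ℤ)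

theorem planeGrid_adj {p q : ℤ × ℤ} :
    planeGrid.Adj p q ↔ |p.1 - q.1| + |p.2 - q.2| = 1 := Iff.rfl

theorem mem_square {m : ℕ} {p : ℤ × ℤ} :
    p ∈ square m ↔ (0 ≤ p.1 ∧ p.1 < m) ∧ 0 ≤ p.2 ∧ p.2 < m := Iff.rfl

theorem abs_sub_le_of_mem_nbhd_comap {V : Type*} {P : V → ℤ × ℤ} {T : ℕ} {u v : V}
    (h : v ∈ nbhd (planeGrid.comap P) T u) :
    |(P v).1 - (P u).1| ≤ T ∧ |(P v).2 - (P u).2| ≤ T := by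
  induction T generalizing v with
  | zero => rw [mem_nbhd_zero] at h; simp [h]
  | succ T ih =>
    push_cast
    rcases mem_nbhd_succ.1 h with h | ⟨w, hw, hadj⟩
    · have := ih h
      omega
    · obtain ⟨hw₁, hw₂⟩ := ih hw
      rw [SimpleGraph.comap_adj, planeGrid_adj] at hadj
      have hrow := abs_sub_le (P v).1 (P w).1 (P u).1
      have hcol := abs_sub_le (P v).2 (P w).2 (P u).2
      rw [abs_sub_comm (P v).1 (P w).1] at hrow
      rw [abs_sub_comm (P v).2 (P w).2] at hcol
      have := abs_nonneg ((P w).1 - (P v).1)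
      have := abs_nonneg ((P w).2 - (P v).2)
      constructor <;> linarith

theorem comap_planeGrid_mem_squareGrids {m : ℕ} {P : Fin (m ^ 2) → ℤ × ℤ}
    (hinj : Function.Injective P) (hP : ∀ u, P u ∈ square m) :
    planeGrid.comap P ∈ squareGrids (m ^ 2) := by
  simp only [mem_square] at hP
  let f : Fin (m ^ 2) → Fin m × Fin m := fun u =>
    (⟨(P u).1.toNat, by have := hP u; omega⟩, ⟨(P u).2.toNat, by have := hP u; omega⟩)
  have hf : Function.Injective f := fun u v huv => hinj <| by
    have hu := hP u
    have hv := hP v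
    simp only [f, Prod.mk.injEq, Fin.mk.injEq] at huv
    ext <;> omega
  have hbij : Function.Bijective f :=
    (Fintype.bijective_iff_injective_and_card f).2 ⟨hf, by simp [sq]⟩
  refine ⟨m, ⟨⟨Equiv.ofBijective f hbij, fun {u v} => ?_⟩⟩⟩
  have hu := hP u
  have hv := hP v
  simp only [Equiv.ofBijective_apply, SimpleGraph.boxProd_adj, SimpleGraph.pathGraph_adj, f,
    SimpleGraph.comap_adj, planeGrid_adj, Fin.mk.injEq]
  grind

theorem range_eq_square {m : ℕ} {P : Fin (m ^ 2) → ℤ × ℤ} (hinj : Function.Injective P)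
    (hP : ∀ u, P u ∈ square m) : Set.range P = square m := by
  refine Set.eq_of_subset_of_ncard_le (Set.range_subset_iff.2 hP) ?_
    ((Set.finite_Ico _ _).prod (Set.finite_Ico _ _))
  rw [← Set.image_univ, Set.ncard_image_of_injective _ hinj, Set.ncard_univ, square,
    Set.ncard_prod, ← Finset.coe_Ico, Set.ncard_coe_finset]
  simp [sq]

theorem squareGrids_subset_bipartiteGraphs (n : ℕ) : squareGrids n ⊆ bipartiteGraphs n := by
  rintro G ⟨m, ⟨e⟩⟩
  refine ⟨SimpleGraph.Coloring.mk
    (fun u => (⟨((e u).1.val + (e u).2.val) % 2, Nat.mod_lt _ two_pos⟩ : Fin 2)) ?_⟩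
  intro u v huv
  have h := e.map_rel_iff.2 huv
  simp only [SimpleGraph.boxProd_adj, SimpleGraph.pathGraph_adj, Fin.ext_iff] at h
  simp only [ne_eq, Fin.mk.injEq]
  omega

theorem isProper_restrict_range {V W C : Type*} {H : SimpleGraph W} {P : V → W} {c : V → C}
    (c₀ : W → C) (hinj : Function.Injective P) (hc : IsProper (H.comap P) c) :
    IsProper (restrict H (Set.range P)) (Function.extend P c c₀) := by
  rintro _ _ ⟨hadj, ⟨u, rfl⟩, v, rfl⟩
  rw [hinj.extend_apply, hinj.extend_apply]
  exact hc u v hadj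

/-- The nodes `0, 1, …` fill the `m × m` grid row by row. -/
def coord (m : ℕ) (u : Fin (m ^ 2)) : ℤ × ℤ := ((u.val / m : ℕ), (u.val % m : ℕ))

theorem coord_injective (m : ℕ) : Function.Injective (coord m) := fun u v h => by
  simp only [coord, Prod.mk.injEq, Nat.cast_inj] at h
  rw [Fin.ext_iff, ← Nat.div_add_mod u.val m, ← Nat.div_add_mod v.val m, h.1, h.2]

theorem coord_mem_square (m : ℕ) (u : Fin (m ^ 2)) : coord m u ∈ square m := by
  have hm : 0 < m := Nat.pos_of_ne_zero fun h => by subst h; exact absurd u.isLt (by simp)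
  have hdiv : u.val / m < m := Nat.div_lt_of_lt_mul (by simpa only [sq] using u.isLt)
  have hmod : u.val % m < m := Nat.mod_lt _ hm
  exact ⟨⟨Int.natCast_nonneg _, Nat.cast_lt.2 hdiv⟩, Int.natCast_nonneg _, Nat.cast_lt.2 hmod⟩

end Grid

/-! ### Rearranging an interval of columns -/

section RigidOn

/-- On the set `s`, the map `f` is a translation or a reflection. -/
def RigidOn (f : ℤ → ℤ) (s : Set ℤ) : Prop :=
  ∃ (ε : ℤˣ) (c : ℤ), ∀ z ∈ s, f z = ε * z + c

variable {f f' : ℤ → ℤ} {s t : Set ℤ}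

theorem rigidOn_id (s : Set ℤ) : RigidOn id s := ⟨1, 0, fun z _ => by simp⟩

theorem RigidOn.mono (hf : RigidOn f t) (h : s ⊆ t) : RigidOn f s :=
  let ⟨ε, c, hf⟩ := hf
  ⟨ε, c, fun z hz => hf z (h hz)⟩

theorem RigidOn.congr (hf : RigidOn f s) (h : Set.EqOn f' f s) : RigidOn f' s :=
  let ⟨ε, c, hf⟩ := hf
  ⟨ε, c, fun z hz => (h hz).trans (hf z hz)⟩

theorem RigidOn.comp (hf : RigidOn f t) (hf' : RigidOn f' s) (h : Set.MapsTo f' s t) :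
    RigidOn (f ∘ f') s := by
  obtain ⟨ε, c, hf⟩ := hf
  obtain ⟨ε', c', hf'⟩ := hf'
  refine ⟨ε * ε', ε * c' + c, fun z hz => ?_⟩
  rw [Function.comp_apply, hf _ (h hz), hf' z hz, Units.val_mul]
  ring

theorem RigidOn.abs_sub (hf : RigidOn f s) {z z' : ℤ} (hz : z ∈ s) (hz' : z' ∈ s) :
    |f z - f z'| = |z - z'| := by
  obtain ⟨ε, c, hf⟩ := hf
  rw [hf z hz, hf z' hz', add_sub_add_right_eq_sub, ← mul_sub, abs_mul,
    Int.isUnit_iff_abs_eq.1 ε.isUnit, one_mul]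

theorem RigidOn.mem_Ico_of_abs_sub_le {a b d z z' : ℤ} (hf : RigidOn f (Set.Ico a b))
    (hinj : Function.Injective f) (hz : z ∈ Set.Ico (a + d) (b - d)) (h : |f z' - f z| ≤ d) :
    z' ∈ Set.Ico a b := by
  obtain ⟨ε, c, hf⟩ := hf
  obtain ⟨hz₁, hz₂⟩ := hz
  rw [hf z ⟨by grind, by grind⟩, abs_le] at h
  have mem_of_eq {w : ℤ} (hw : w ∈ Set.Ico a b) (heq : ε * w + c = f z') : z' ∈ Set.Ico a b := by
    rwa [hinj ((hf w hw).trans heq)] at hw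
  rcases Int.units_eq_one_or ε with rfl | rfl
  · simp only [Units.val_one, one_mul] at h mem_of_eq
    exact mem_of_eq (w := f z' - c) ⟨by omega, by omega⟩ (by ring)
  · simp only [Units.val_neg, Units.val_one, neg_mul, one_mul] at h mem_of_eq
    exact mem_of_eq (w := c - f z') ⟨by omega, by omega⟩ (by ring)

end RigidOn

section Place

/-- The reflection of the interval `[0, L)`. -/
def rev (L : ℤ) : Equiv.Perm ℤ :=
  Function.Involutive.toPerm (fun x => if 0 ≤ x ∧ x < L then L - 1 - x else x) fun x => by
    dsimp only
    split_ifs <;> omega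

theorem rev_apply (L x : ℤ) : rev L x = if 0 ≤ x ∧ x < L then L - 1 - x else x := rfl

/-- The final placement of the interval `[0, e)`: it is moved to `[θ.2, e + θ.2)`, by a reflection
if `θ.1` and by a translation otherwise. -/
def place (e : ℕ) (θ : Bool × ℕ) : Equiv.Perm ℤ :=
  rev (e + θ.2) * if θ.1 then 1 else rev e

variable {e : ℕ}

theorem place_of_mem_Ico (θ : Bool × ℕ) {x : ℤ} (hx : x ∈ Set.Ico (0 : ℤ) e) :
    place e θ x = if θ.1 then e + θ.2 - 1 - x else x + θ.2 := by
  obtain ⟨hx₁, hx₂⟩ := hx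
  rcases θ with ⟨_ | _, t⟩ <;>
    simp only [place, Bool.false_eq_true, if_true, if_false, Equiv.Perm.mul_apply,
      Equiv.Perm.one_apply, rev_apply] <;>
    split_ifs <;> omega

theorem place_mem_Ico {θ : Bool × ℕ} {m : ℕ} (h : e + θ.2 ≤ m) {x : ℤ}
    (hx : x ∈ Set.Ico (0 : ℤ) m) : place e θ x ∈ Set.Ico (0 : ℤ) m := by
  rcases θ with ⟨_ | _, t⟩ <;>
    simp only [place, Bool.false_eq_true, if_true, if_false, Equiv.Perm.mul_apply,
      Equiv.Perm.one_apply, rev_apply, Set.mem_Ico] at h hx ⊢ <;>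
    split_ifs <;> omega

theorem rigidOn_place (e : ℕ) (θ : Bool × ℕ) : RigidOn (place e θ) (Set.Ico 0 e) := by
  rcases hθ : θ.1 with _ | _
  · exact ⟨1, θ.2, fun z hz => by simp [place_of_mem_Ico θ hz, hθ]⟩
  · exact ⟨-1, e + θ.2 - 1, fun z hz => by
      rw [place_of_mem_Ico θ hz, hθ, if_pos rfl, Units.val_neg, Units.val_one]; ring⟩

end Place

/-! ### The hierarchy of tiles -/

section Tile

variable (g k : ℕ)

/-- The length of the tiles of level `j` in a hierarchy of `k` levels with margins of width `g`. -/
def tile (j : ℕ) : ℕ := 2 ^ j * (2 * (k + 1) * g + 2)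

/-- The `p`-th tile of level `j` without `d` margins on both sides. -/
noncomputable def core (j d : ℕ) (p : ℤ) : Finset ℤ :=
  Finset.Ico (p * tile g k j + d * g) ((p + 1) * tile g k j - d * g)

/-- The part of the `p`-th tile of level `j` that may be reflected. -/
noncomputable abbrev zone (j : ℕ) (p : ℤ) : Finset ℤ := core g k j (k - j) p

/-- The part of the `p`-th tile of level `j` that is coloured before the reflections of level `j`
become visible; being one margin away from the end of the zone, it lies in the next larger
zone. -/
noncomputable abbrev slot (j : ℕ) (p : ℤ) : Finset ℤ := core g k j (k + 1 - j) p

/-- The indices of the tiles of level `j`. -/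
noncomputable def tiles (j : ℕ) : Finset ℤ := Finset.Ico 0 (2 ^ (k - j))

variable {g k}

theorem tile_pos (j : ℕ) : (0 : ℤ) < tile g k j := by unfold tile; positivity

theorem tile_add (i r : ℕ) : tile g k (i + r) = 2 ^ r * tile g k i := by unfold tile; ring

theorem even_tile (j : ℕ) : Even (tile g k j) := ⟨2 ^ j * ((k + 1) * g + 1), by unfold tile; ring⟩

theorem core_nonempty {j d : ℕ} (hd : d ≤ k + 1) (p : ℤ) : (core g k j d p).Nonempty := by
  have hlt : 2 * (d * g) < tile g k j :=
    calc 2 * (d * g) ≤ 2 * (k + 1) * g := by rw [← mul_assoc]; gcongr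
      _ < 2 * (k + 1) * g + 2 := by omega
      _ ≤ tile g k j := Nat.le_mul_of_pos_left _ (by positivity)
  rw [core, Finset.nonempty_Ico, add_one_mul]
  have : (2 : ℤ) * (d * g) < tile g k j := by exact_mod_cast hlt
  linarith

theorem ediv_tile_of_mem_core {j d : ℕ} {p x : ℤ} (hx : x ∈ core g k j d p) :
    x / tile g k j = p := by
  rw [core, Finset.mem_Ico] at hx
  have hd : (0 : ℤ) ≤ d * g := by positivity
  rw [Int.ediv_eq_iff_of_pos (tile_pos j)]
  constructor <;> linarith

theorem core_subset_core {i r d d' : ℕ} (hd : d' ≤ d) (q : ℤ) :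
    core g k i d q ⊆ core g k (i + r) d' (q / 2 ^ r) := by
  have htile := (tile_pos (g := g) (k := k) i).le
  have hfloor : q / 2 ^ r * 2 ^ r ≤ q := Int.ediv_mul_le q (by positivity)
  have hceil : q + 1 ≤ (q / 2 ^ r + 1) * 2 ^ r := Int.lt_ediv_add_one_mul_self q (by positivity)
  have hmargin : (d' * g : ℤ) ≤ d * g := by gcongr
  have hleft := mul_le_mul_of_nonneg_right hfloor htile
  have hright := mul_le_mul_of_nonneg_right hceil htile
  rw [mul_assoc] at hleft hright
  rw [core, core, tile_add]
  push_cast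
  exact Finset.Ico_subset_Ico (by linarith) (by linarith)

theorem slot_subset_zone (j : ℕ) (p : ℤ) : slot g k j p ⊆ zone g k j p := by
  simpa using core_subset_core (g := g) (k := k) (i := j) (r := 0)
    (show k - j ≤ k + 1 - j by omega) p

theorem zone_subset_slot (j : ℕ) (p : ℤ) : zone g k j p ⊆ slot g k (j + 1) (p / 2) := by
  simpa only [pow_one] using core_subset_core (g := g) (k := k) (i := j) (r := 1)
    (show k + 1 - (j + 1) ≤ k - j by omega) p

theorem slot_subset_slot (j : ℕ) (p : ℤ) : slot g k j p ⊆ slot g k (j + 1) (p / 2) :=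
  (slot_subset_zone j p).trans (zone_subset_slot j p)

theorem ediv_two_mem_tiles {j : ℕ} {p : ℤ} (hp : p ∈ tiles k j) : p / 2 ∈ tiles k (j + 1) := by
  rw [tiles, Finset.mem_Ico] at *
  rcases lt_or_ge j k with hj | hj
  · rw [show k - j = k - (j + 1) + 1 by omega, pow_succ] at hp
    omega
  · rw [show k - j = 0 by omega] at hp
    rw [show k - (j + 1) = 0 by omega]
    omega

theorem tiles_self : tiles k k = {0} := by rw [tiles, Nat.sub_self, pow_zero]; rfl

theorem coe_core_top : (core g k k 0 0 : Set ℤ) = Set.Ico 0 (tile g k k : ℤ) := by simp [core]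

theorem core_subset_core_top {j d : ℕ} {p : ℤ} (hj : j ≤ k) (hp : p ∈ tiles k j) :
    core g k j d p ⊆ core g k k 0 0 := by
  rw [tiles, Finset.mem_Ico] at hp
  have h := core_subset_core (g := g) (k := k) (i := j) (r := k - j) d.zero_le p
  rwa [Int.ediv_eq_zero_of_lt hp.1 hp.2, Nat.add_sub_cancel' hj] at h

theorem sum_tiles {M : Type*} [AddCommMonoid M] {j : ℕ} (hj : j < k) (f : ℤ → M) :
    ∑ p ∈ tiles k j, f p = ∑ p ∈ tiles k (j + 1), (f (2 * p) + f (2 * p + 1)) := by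
  have hdisj : Disjoint ((tiles k (j + 1)).image (2 * ·))
      ((tiles k (j + 1)).image (2 * · + 1)) := by
    simp only [Finset.disjoint_left, Finset.mem_image]
    rintro _ ⟨p, _, rfl⟩ ⟨q, _, hq⟩
    omega
  have hunion : tiles k j = (tiles k (j + 1)).image (2 * ·) ∪
      (tiles k (j + 1)).image (2 * · + 1) := by
    have hpow : (2 : ℤ) ^ (k - j) = 2 ^ (k - (j + 1)) * 2 := by
      rw [← pow_succ]; congr 1; omega
    ext p
    simp only [tiles, Finset.mem_union, Finset.mem_image, Finset.mem_Ico, hpow]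
    constructor
    · intro hp
      rcases Int.even_or_odd' p with ⟨q, rfl | rfl⟩
      · exact Or.inl ⟨q, by omega, rfl⟩
      · exact Or.inr ⟨q, by omega, rfl⟩
    · rintro (⟨q, hq, rfl⟩ | ⟨q, hq, rfl⟩) <;> omega
  rw [hunion, Finset.sum_union hdisj, Finset.sum_image (by intro; grind),
    Finset.sum_image (by intro; grind), Finset.sum_add_distrib]

end Tile

section Arrange

variable {g k : ℕ}

theorem reflect_mem_core {j d : ℕ} {p x : ℤ} (hx : x ∈ core g k j d p) :
    (2 * p + 1) * tile g k j - 1 - x ∈ core g k j d p := by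
  rw [core, Finset.mem_Ico] at *
  have h : (2 * p + 1) * (tile g k j : ℤ) = p * tile g k j + (p + 1) * tile g k j := by ring
  rw [h]
  omega

open Classical in
/-- The rearrangement that, if `j ∈ S`, reflects the zones of all tiles of level `j` with an odd
index. -/
noncomputable def flip (g k : ℕ) (S : Finset ℕ) (j : ℕ) : Equiv.Perm ℤ :=
  Function.Involutive.toPerm
    (fun x => let p := x / tile g k j
      if j ∈ S ∧ p ∈ tiles k j ∧ Odd p ∧ x ∈ zone g k j p
        then (2 * p + 1) * tile g k j - 1 - x else x) fun x => by
    dsimp only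
    split_ifs with h h'
    · rw [ediv_tile_of_mem_core (reflect_mem_core h.2.2.2)]
      ring
    · have hx' := reflect_mem_core h.2.2.2
      rw [ediv_tile_of_mem_core hx'] at h'
      exact absurd ⟨h.1, h.2.1, h.2.2.1, hx'⟩ h'
    · rfl

/-- The arrangement of the columns after the reflections of the levels below `j`, of which those
in `S` are performed. -/
noncomputable def arrange (g k : ℕ) (S : Finset ℕ) : ℕ → Equiv.Perm ℤ
  | 0 => 1
  | j + 1 => flip g k S j * arrange g k S j

/-- The rearrangement of the columns by the reflections of the levels from `j` on. -/
noncomputable def later (g k : ℕ) (S : Finset ℕ) (j : ℕ) : Equiv.Perm ℤ :=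
  arrange g k S k * (arrange g k S j)⁻¹

variable {S S' : Finset ℕ} {i j d : ℕ} {p q x : ℤ}

theorem flip_of_odd (hj : j ∈ S) (hp : p ∈ tiles k j) (hodd : Odd p) (hx : x ∈ zone g k j p) :
    flip g k S j x = (2 * p + 1) * tile g k j - 1 - x := by
  obtain rfl := ediv_tile_of_mem_core hx
  exact if_pos ⟨hj, hp, hodd, hx⟩

theorem flip_of_even (hp : Even p) (hx : x ∈ zone g k j p) : flip g k S j x = x := by
  obtain rfl := ediv_tile_of_mem_core hx
  exact if_neg fun h => Int.not_even_iff_odd.2 h.2.2.1 hp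

theorem flip_of_notMem (hj : j ∉ S) : flip g k S j = 1 :=
  Equiv.ext fun _ => if_neg fun h => hj h.1

theorem flip_flip (x : ℤ) : flip g k S j (flip g k S j x) = x :=
  Function.Involutive.toPerm_involutive _ x

theorem flip_eq_self_or (x : ℤ) : flip g k S j x = x ∨
    ∃ p ∈ tiles k j, x ∈ zone g k j p ∧ flip g k S j x ∈ zone g k j p := by
  by_cases h : j ∈ S ∧ x / tile g k j ∈ tiles k j ∧ Odd (x / tile g k j) ∧
      x ∈ zone g k j (x / tile g k j)
  · obtain ⟨hj, hp, hodd, hx⟩ := h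
    refine Or.inr ⟨_, hp, hx, ?_⟩
    rw [flip_of_odd hj hp hodd hx]
    exact reflect_mem_core hx
  · exact Or.inl (if_neg h)

theorem flip_mem_core (hij : i ≤ j) (hd : d ≤ k - i) (hx : x ∈ core g k j d q) :
    flip g k S i x ∈ core g k j d q := by
  rcases flip_eq_self_or (g := g) (S := S) (j := i) x with h | ⟨p, -, hp, hp'⟩
  · rwa [h]
  · obtain ⟨r, rfl⟩ := Nat.exists_eq_add_of_le hij
    have hsub := core_subset_core (g := g) (k := k) (i := i) (r := r) hd p
    rw [← ediv_tile_of_mem_core hx, ediv_tile_of_mem_core (hsub hp)]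
    exact hsub hp'

theorem flip_mem_Ico {m : ℕ} (hj : j ≤ k) (hm : tile g k k ≤ m) (hx : x ∈ Set.Ico (0 : ℤ) m) :
    flip g k S j x ∈ Set.Ico (0 : ℤ) m := by
  rcases flip_eq_self_or (g := g) (k := k) (S := S) (j := j) x with h | ⟨p, hp, -, hx'⟩
  · rwa [h]
  · have htop : flip g k S j x ∈ (core g k k 0 0 : Set ℤ) := core_subset_core_top hj hp hx'
    rw [coe_core_top] at htop
    exact ⟨htop.1, htop.2.trans_le (by exact_mod_cast hm)⟩

theorem rigidOn_flip (g : ℕ) (S : Finset ℕ) (hp : p ∈ tiles k j) :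
    RigidOn (flip g k S j) (zone g k j p) := by
  by_cases h : j ∈ S ∧ Odd p
  · exact ⟨-1, (2 * p + 1) * tile g k j - 1, fun z hz => by
      rw [flip_of_odd h.1 hp h.2 hz, Units.val_neg, Units.val_one]; ring⟩
  · refine (rigidOn_id _).congr fun z hz => ?_
    rcases not_and_or.1 h with hj | hodd
    · rw [flip_of_notMem hj]; rfl
    · exact flip_of_even (Int.not_odd_iff_even.1 hodd) hz

theorem arrange_congr (h : ∀ i < j, i ∈ S ↔ i ∈ S') : arrange g k S j = arrange g k S' j := by
  induction j with
  | zero => rfl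
  | succ j ih =>
    simp only [arrange, flip, h j j.lt_succ_self, ih fun i hi => h i (hi.trans j.lt_succ_self)]

theorem arrange_mem_core_iff (hij : i ≤ j) (hd : d ≤ k + 1 - i) :
    arrange g k S i x ∈ core g k j d q ↔ x ∈ core g k j d q := by
  induction i with
  | zero => rfl
  | succ i ih =>
    rw [← ih (by omega) (by omega), arrange, Equiv.Perm.mul_apply]
    refine ⟨fun h => ?_, flip_mem_core (by omega) (by omega)⟩
    simpa only [flip_flip] using flip_mem_core (i := i) (S := S) (by omega) (by omega) h

theorem arrange_mem_Ico {m : ℕ} (hj : j ≤ k) (hm : tile g k k ≤ m)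
    (hx : x ∈ Set.Ico (0 : ℤ) m) : arrange g k S j x ∈ Set.Ico (0 : ℤ) m := by
  induction j with
  | zero => exact hx
  | succ j ih => exact flip_mem_Ico (by omega) hm (ih (by omega))

theorem later_self : later g k S k = 1 := mul_inv_cancel _

theorem later_eq_mul_flip (j : ℕ) : later g k S j = later g k S (j + 1) * flip g k S j := by
  simp only [later, arrange]
  group

theorem later_mem_core_top (hj : j ≤ k) (hx : x ∈ core g k k 0 0) :
    later g k S j x ∈ core g k k 0 0 := by
  rw [later, Equiv.Perm.mul_apply, arrange_mem_core_iff le_rfl (Nat.zero_le _)]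
  rwa [← arrange_mem_core_iff (i := j) (S := S) hj (Nat.zero_le _), ← Equiv.Perm.mul_apply,
    mul_inv_cancel, Equiv.Perm.one_apply]

theorem rigidOn_later (g : ℕ) (S : Finset ℕ) (hj : j ≤ k) (hp : p ∈ tiles k j) :
    RigidOn (later g k S j) (zone g k j p) := by
  induction hj using Nat.decreasingInduction generalizing p with
  | self => rw [later_self]; exact rigidOn_id _
  | of_succ j _ ih =>
    have hsub : zone g k j p ⊆ zone g k (j + 1) (p / 2) :=
      (zone_subset_slot j p).trans (slot_subset_zone _ _)
    rw [later_eq_mul_flip, Equiv.Perm.coe_mul]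
    exact (ih (ediv_two_mem_tiles hp)).comp (rigidOn_flip g S hp) fun x hx =>
      hsub (flip_mem_core le_rfl le_rfl hx)

end Arrange

/-! ### Heights of three-colourings -/

section Height

/-- The increment of the height along an edge from colour `a` to colour `b`; the value for `a = b`
is irrelevant. -/
def step (a b : Fin 3) : ℤ := if b = a + 1 then 1 else -1

theorem step_swap {a b : Fin 3} (h : a ≠ b) : step b a = -step a b := by
  revert a b; decide

theorem step_square {a b c d : Fin 3} (hab : a ≠ b) (hbc : b ≠ c) (had : a ≠ d) (hdc : d ≠ c) :
    step a b + step b c = step a d + step d c := by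
  revert a b c d; decide

theorem abs_step (a b : Fin 3) : |step a b| = 1 := by
  revert a b; decide

/-- The height function of a sequence of colours: consecutive heights differ by the `step` between
the colours, and the height at `0` is `0`. -/
noncomputable def height (f : ℤ → Fin 3) (z : ℤ) : ℤ :=
  ∑ i ∈ Finset.Ico 0 z, step (f i) (f (i + 1)) - ∑ i ∈ Finset.Ico z 0, step (f i) (f (i + 1))

variable {f f' f₀ f₁ : ℤ → Fin 3} {φ φ₀ φ₁ : ℤ → ℤ} {s s₁ s₂ t : Finset ℤ}

theorem height_succ (f : ℤ → Fin 3) (z : ℤ) :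
    height f (z + 1) = height f z + step (f z) (f (z + 1)) := by
  rcases le_or_gt 0 z with hz | hz
  · rw [height, height, Finset.Ico_eq_empty_of_le hz,
      Finset.Ico_eq_empty_of_le (show 0 ≤ z + 1 by omega),
      ← Finset.insert_Ico_right_eq_Ico_add_one hz, Finset.sum_insert Finset.right_notMem_Ico]
    ring
  · rw [height, height, Finset.Ico_eq_empty_of_le hz.le,
      Finset.Ico_eq_empty_of_le (show z + 1 ≤ 0 by omega),
      ← Finset.insert_Ico_add_one_left_eq_Ico hz, Finset.sum_insert (by simp)]
    ring

theorem even_height_add (f : ℤ → Fin 3) (z : ℤ) : Even (height f z + z) := by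
  have iff_succ (z : ℤ) : Even (height f (z + 1) + (z + 1)) ↔ Even (height f z + z) := by
    have := abs_step (f z) (f (z + 1))
    rw [height_succ]
    grind
  induction z with
  | zero => simp [height]
  | succ z ih => rwa [iff_succ]
  | pred z ih => rwa [← iff_succ, sub_add_cancel]

/-- The map `φ` moves the sequence of colours `f` on `s` into the sequence `f'` on `t` without
changing any difference of heights. -/
structure HeightPreserving (f f' : ℤ → Fin 3) (φ : ℤ → ℤ) (s t : Finset ℤ) : Prop where
  mapsTo : ∀ z ∈ s, φ z ∈ t
  sub_eq : ∀ u ∈ s, ∀ v ∈ s, height f' (φ v) - height f' (φ u) = height f v - height f u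

theorem RigidOn.heightPreserving {a b : ℤ} (hφ : RigidOn φ (Finset.Ico a b))
    (hmaps : ∀ z ∈ Finset.Ico a b, φ z ∈ t)
    (hne : ∀ z ∈ Finset.Ico a b, z + 1 ∈ Finset.Ico a b → f z ≠ f (z + 1))
    (hf : ∀ z ∈ Finset.Ico a b, f' (φ z) = f z) :
    HeightPreserving f f' φ (Finset.Ico a b) t := by
  refine ⟨hmaps, ?_⟩
  suffices H : ∀ z, a ≤ z → z < b →
      height f' (φ z) - height f' (φ a) = height f z - height f a by
    intro u hu v hv
    rw [Finset.mem_Ico] at hu hv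
    linarith [H u hu.1 hu.2, H v hv.1 hv.2]
  obtain ⟨ε, c, hφ⟩ := hφ
  intro z hz
  induction z, hz using Int.leInduction with
  | base => simp
  | succ z hz ih =>
    intro hb
    have hmem : z ∈ Finset.Ico a b := Finset.mem_Ico.2 ⟨hz, by omega⟩
    have hmem' : z + 1 ∈ Finset.Ico a b := Finset.mem_Ico.2 ⟨by omega, hb⟩
    have hcol := hf z hmem
    have hcol' := hf (z + 1) hmem'
    have hpos := hφ z hmem
    have hpos' := hφ (z + 1) hmem'
    have ih := ih (by omega)
    rw [height_succ f]
    rcases Int.units_eq_one_or ε with rfl | rfl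
    · have hnext : φ (z + 1) = φ z + 1 := by rw [hpos, hpos', Units.val_one]; ring
      rw [hnext] at hcol' ⊢
      rw [height_succ, hcol, hcol']
      linarith
    · have hnext : φ z = φ (z + 1) + 1 := by
        rw [hpos, hpos', Units.val_neg, Units.val_one]; ring
      have hstep := height_succ f' (φ (z + 1))
      rw [← hnext, hcol, hcol', step_swap (hne z hmem hmem')] at hstep
      linarith

/-- The difference between the largest and the smallest height on `s`. -/
noncomputable def spread (f : ℤ → Fin 3) (s : Finset ℤ) : ℕ :=
  (s ×ˢ s).sup fun q => (height f q.1 - height f q.2).natAbs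

theorem sub_le_spread {u v : ℤ} (f : ℤ → Fin 3) (hu : u ∈ s) (hv : v ∈ s) :
    height f v - height f u ≤ spread f s := by
  have : (height f v - height f u).natAbs ≤ spread f s :=
    Finset.le_sup (f := fun q : ℤ × ℤ => (height f q.1 - height f q.2).natAbs) (b := (v, u))
      (Finset.mk_mem_product hv hu)
  omega

theorem exists_spread_eq (f : ℤ → Fin 3) (hs : s.Nonempty) :
    ∃ u ∈ s, ∃ v ∈ s, height f v - height f u = spread f s := by
  obtain ⟨⟨u, v⟩, hq, h⟩ := Finset.exists_mem_eq_sup _ (hs.product hs)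
    fun q : ℤ × ℤ => (height f q.1 - height f q.2).natAbs
  obtain ⟨hu, hv⟩ := Finset.mem_product.1 hq
  replace h : spread f s = (height f u - height f v).natAbs := h
  rcases le_total (height f u) (height f v) with hle | hle
  · exact ⟨u, hu, v, hv, by omega⟩
  · exact ⟨v, hv, u, hu, by omega⟩

theorem HeightPreserving.spread_le (h : HeightPreserving f f' φ s t) (hs : s.Nonempty) :
    spread f s ≤ spread f' t := by
  obtain ⟨u, hu, v, hv, huv⟩ := exists_spread_eq f hs
  exact_mod_cast huv ▸ h.sub_eq u hu v hv ▸ sub_le_spread f' (h.mapsTo u hu) (h.mapsTo v hv)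

-- The parity of the height is that of the position.
theorem even_sub_of_spread_le {u₁ v₁ u₂ v₂ : ℤ} {r : ℕ} (hu₁ : u₁ ∈ s) (hv₁ : v₁ ∈ s)
    (hu₂ : u₂ ∈ s) (hv₂ : v₂ ∈ s) (h₁ : height f v₁ - height f u₁ = r)
    (h₂ : height f v₂ - height f u₂ = r) (h : spread f s ≤ r) : Even (v₂ - v₁) := by
  have hle := sub_le_spread f hu₁ hv₂
  have hge := sub_le_spread f hu₂ hv₁
  have heq : height f v₁ = height f v₂ := by omega
  have heven₁ := even_height_add f v₁
  have heven₂ := even_height_add f v₂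
  grind

theorem spread_lt_or_of_even_of_odd (hs₁ : s₁.Nonempty) (hs₂ : s₂.Nonempty)
    (h₀₁ : HeightPreserving f f₀ φ₀ s₁ t) (h₀₂ : HeightPreserving f f₀ φ₀ s₂ t)
    (h₁₁ : HeightPreserving f f₁ φ₁ s₁ t) (h₁₂ : HeightPreserving f f₁ φ₁ s₂ t)
    (heven : ∀ z ∈ s₁, Even (φ₁ z - φ₀ z)) (hodd : ∀ z ∈ s₂, Odd (φ₁ z - φ₀ z))
    (heq : spread f s₁ = spread f s₂) :
    spread f s₁ < spread f₀ t ∨ spread f s₁ < spread f₁ t := by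
  by_contra! hle
  obtain ⟨u₁, hu₁, v₁, hv₁, e₁⟩ := exists_spread_eq f hs₁
  obtain ⟨u₂, hu₂, v₂, hv₂, e₂⟩ := exists_spread_eq f hs₂
  rw [← heq] at e₂
  have heven₀ := even_sub_of_spread_le (h₀₁.mapsTo u₁ hu₁) (h₀₁.mapsTo v₁ hv₁)
    (h₀₂.mapsTo u₂ hu₂) (h₀₂.mapsTo v₂ hv₂) ((h₀₁.sub_eq u₁ hu₁ v₁ hv₁).trans e₁)
    ((h₀₂.sub_eq u₂ hu₂ v₂ hv₂).trans e₂) hle.1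
  have heven₁ := even_sub_of_spread_le (h₁₁.mapsTo u₁ hu₁) (h₁₁.mapsTo v₁ hv₁)
    (h₁₂.mapsTo u₂ hu₂) (h₁₂.mapsTo v₂ hv₂) ((h₁₁.sub_eq u₁ hu₁ v₁ hv₁).trans e₁)
    ((h₁₂.sub_eq u₂ hu₂ v₂ hv₂).trans e₂) hle.2
  have := heven v₁ hv₁
  have := hodd v₂ hv₂
  grind

theorem half_pow_add_half_pow_le {r₁ r₂ R₀ R₁ : ℕ} (h₀₁ : r₁ ≤ R₀) (h₀₂ : r₂ ≤ R₀)
    (h₁₁ : r₁ ≤ R₁) (h₁₂ : r₂ ≤ R₁) (hlt : r₁ = r₂ → r₁ < R₀ ∨ r₁ < R₁) :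
    (1 / 2 : ℝ) ^ R₀ + (1 / 2) ^ R₁ ≤ 3 / 4 * ((1 / 2) ^ r₁ + (1 / 2) ^ r₂) := by
  have anti {i j : ℕ} (h : i ≤ j) : (1 / 2 : ℝ) ^ j ≤ (1 / 2) ^ i :=
    pow_le_pow_of_le_one (by norm_num) (by norm_num) h
  have half {i j : ℕ} (h : i < j) : (1 / 2 : ℝ) ^ j ≤ 1 / 2 * (1 / 2) ^ i := by
    rw [← pow_succ']
    exact anti h
  rcases lt_trichotomy r₁ r₂ with hr | rfl | hr
  · linarith [half hr, anti h₀₂, anti h₁₂, show (0 : ℝ) < (1 / 2) ^ r₂ by positivity]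
  · rcases hlt rfl with h | h
    · linarith [half h, anti h₁₁]
    · linarith [half h, anti h₀₁]
  · linarith [half hr, anti h₀₁, anti h₁₁, show (0 : ℝ) < (1 / 2) ^ r₁ by positivity]

theorem half_pow_spread_add_le (hs₁ : s₁.Nonempty) (hs₂ : s₂.Nonempty)
    (h₀₁ : HeightPreserving f f₀ φ₀ s₁ t) (h₀₂ : HeightPreserving f f₀ φ₀ s₂ t)
    (h₁₁ : HeightPreserving f f₁ φ₁ s₁ t) (h₁₂ : HeightPreserving f f₁ φ₁ s₂ t)
    (heven : ∀ z ∈ s₁, Even (φ₁ z - φ₀ z)) (hodd : ∀ z ∈ s₂, Odd (φ₁ z - φ₀ z)) :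
    (1 / 2 : ℝ) ^ spread f₀ t + (1 / 2) ^ spread f₁ t ≤
      3 / 4 * ((1 / 2) ^ spread f s₁ + (1 / 2) ^ spread f s₂) :=
  half_pow_add_half_pow_le (h₀₁.spread_le hs₁) (h₀₂.spread_le hs₂) (h₁₁.spread_le hs₁)
    (h₁₂.spread_le hs₂) (spread_lt_or_of_even_of_odd hs₁ hs₂ h₀₁ h₀₂ h₁₁ h₁₂ heven hodd)

variable {c : ℤ × ℤ → Fin 3} {m : ℕ}

theorem step_add_height_row (hc : IsProper (restrict planeGrid (square m)) c) {y x x' : ℤ}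
    (hy : 0 ≤ y) (hym : y + 1 < m) (hx : 0 ≤ x) (hxx' : x ≤ x') (hx'm : x' < m) :
    step (c (y, x)) (c (y + 1, x)) +
        (height (fun z => c (y + 1, z)) x' - height (fun z => c (y + 1, z)) x) =
      (height (fun z => c (y, z)) x' - height (fun z => c (y, z)) x) +
        step (c (y, x')) (c (y + 1, x')) := by
  induction x', hxx' using Int.leInduction with
  | base => simp
  | succ x' hxx' ih =>
    have ih := ih (by omega)
    have ne {p q : ℤ × ℤ} (h : |p.1 - q.1| + |p.2 - q.2| = 1) (hp : p ∈ square m)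
        (hq : q ∈ square m) : c p ≠ c q := hc p q ⟨h, hp, hq⟩
    have hmem₀ : (y, x') ∈ square m := ⟨⟨hy, by grind⟩, by grind, by grind⟩
    have hmem₁ : (y, x' + 1) ∈ square m := ⟨⟨hy, by grind⟩, by grind, hx'm⟩
    have hmem₂ : (y + 1, x') ∈ square m := ⟨⟨by grind, hym⟩, by grind, by grind⟩
    have hmem₃ : (y + 1, x' + 1) ∈ square m := ⟨⟨by grind, hym⟩, by grind, hx'm⟩
    have hsquare := step_square (ne (by simp) hmem₀ hmem₁) (ne (by simp) hmem₁ hmem₃)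
      (ne (by simp) hmem₀ hmem₂) (ne (by simp) hmem₂ hmem₃)
    rw [height_succ, height_succ]
    linarith

theorem abs_height_row_sub_le (hc : IsProper (restrict planeGrid (square m)) c) {y x x' : ℤ}
    {n : ℕ} (hy : 0 ≤ y) (hym : y + n < m) (hx : 0 ≤ x ∧ x < m) (hx' : 0 ≤ x' ∧ x' < m) :
    |(height (fun z => c (y + n, z)) x' - height (fun z => c (y + n, z)) x) -
      (height (fun z => c (y, z)) x' - height (fun z => c (y, z)) x)| ≤ 2 * n := by
  wlog hxx' : x ≤ x' generalizing x x'
  · rw [← abs_neg]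
    convert this hx' hx (le_of_not_ge hxx') using 2
    ring
  induction n with
  | zero => simp
  | succ n ih =>
    push_cast at hym ⊢
    have := ih (by omega)
    have hrow := step_add_height_row hc (y := y + n) (by omega) (by omega) hx.1 hxx' hx'.2
    have hstep := abs_step (c (y + n, x)) (c (y + n + 1, x))
    have hstep' := abs_step (c (y + n, x')) (c (y + n + 1, x'))
    rw [← add_assoc]
    grind

end Height

/-! ### The adversary -/

section Adversary

/-- The row to be coloured first in each half of the grid; the radius-`(T + 1)` neighbourhoods of
the two rows are disjoint. -/
def mainRow (T : ℕ) (h : Bool) : ℤ := if h then 0 else 2 * T + 3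

/-- The half of the grid to which row `y` belongs. -/
def halfOf (T : ℕ) (y : ℤ) : Bool := decide (y < T + 2)

theorem halfOf_eq_of_abs_sub_le {T : ℕ} {h : Bool} {y : ℤ} (hy : |y - mainRow T h| ≤ T + 1) :
    halfOf T y = h := by
  rw [abs_le] at hy
  cases h <;> simp only [halfOf, mainRow, Bool.false_eq_true, if_true, if_false,
    decide_eq_false_iff_not, decide_eq_true_eq] at hy ⊢ <;> omega

theorem halfOf_mainRow (T : ℕ) (h : Bool) : halfOf T (mainRow T h) = h :=
  halfOf_eq_of_abs_sub_le (by rw [sub_self, abs_zero]; positivity)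

/-- The number of columns that are rearranged. -/
abbrev width (T k : ℕ) : ℕ := tile (T + 1) k k

/-- The choices for the final placements of the columns in the two halves of the grid. -/
def placements (T k : ℕ) : Finset (Bool → Bool × ℕ) :=
  Fintype.piFinset fun _ => Finset.univ ×ˢ Finset.range (width T k + 1)

/-- The movement of the columns in half `h` of the grid from their arrangement after the levels
below `j` to their final positions. -/
noncomputable def columnMap (T k : ℕ) (S : Finset ℕ) (θ : Bool → Bool × ℕ) (h : Bool) (j : ℕ) :
    Equiv.Perm ℤ :=
  place (width T k) (θ h) * later (T + 1) k S j

/-- The position of a node in the grid that belongs to the reflections `S` and the final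
placements `θ`. -/
noncomputable def position (T k m : ℕ) (S : Finset ℕ) (θ : Bool → Bool × ℕ) (u : Fin (m ^ 2)) :
    ℤ × ℤ :=
  ((coord m u).1, columnMap T k S θ (halfOf T (coord m u).1) 0 (coord m u).2)

/-- The nodes to be coloured before the reflections of level `j` become visible. -/
def early (T k m j : ℕ) : Set (Fin (m ^ 2)) :=
  {u | ∃ h, ∃ p ∈ tiles k j, (coord m u).1 = mainRow T h ∧ (coord m u).2 ∈ slot (T + 1) k j p}

variable {T k m j : ℕ} {S S' : Finset ℕ} {θ θ' : Bool → Bool × ℕ} {h : Bool} {p x z : ℤ}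

theorem two_mul_add_three_lt_width (T k : ℕ) : 2 * T + 3 < width T k :=
  calc 2 * T + 3 < 1 * (2 * 1 * (T + 1) + 2) := by omega
    _ ≤ width T k := by unfold width tile; gcongr <;> first | exact Nat.one_le_two_pow | omega

theorem mainRow_mem_Ico (h : Bool) (hm : width T k ≤ m) : mainRow T h ∈ Set.Ico (0 : ℤ) m := by
  have := two_mul_add_three_lt_width T k
  cases h <;> simp only [mainRow, Bool.false_eq_true, if_true, if_false, Set.mem_Ico] <;> omega

theorem mem_placements : θ ∈ placements T k ↔ ∀ h, (θ h).2 ≤ width T k := by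
  simp [placements]

theorem early_monotone (T k m : ℕ) : Monotone (early T k m) :=
  monotone_nat_of_le_succ fun j _ ⟨h, p, hp, hrow, hcol⟩ =>
    ⟨h, p / 2, ediv_two_mem_tiles hp, hrow,
      zone_subset_slot j p (slot_subset_zone j p hcol)⟩

theorem columnMap_arrange (x : ℤ) :
    columnMap T k S θ h j (arrange (T + 1) k S j x) = columnMap T k S θ h 0 x := by
  rw [← Equiv.Perm.mul_apply, columnMap, columnMap, mul_assoc, later, later, inv_mul_cancel_right,
    arrange, inv_one, mul_one]

theorem columnMap_flip (z : ℤ) :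
    columnMap T k S θ h (j + 1) (flip (T + 1) k S j z) = columnMap T k S θ h j z := by
  rw [← Equiv.Perm.mul_apply, columnMap, columnMap, mul_assoc, ← later_eq_mul_flip]

theorem columnMap_mem_Ico (hθ : θ ∈ placements T k) (hm : 2 * width T k ≤ m)
    (hx : x ∈ Set.Ico (0 : ℤ) m) : columnMap T k S θ h 0 x ∈ Set.Ico (0 : ℤ) m := by
  have hshift := mem_placements.1 hθ h
  rw [← columnMap_arrange (j := k), columnMap, later_self, mul_one]
  exact place_mem_Ico (e := width T k) (by omega)
    (arrange_mem_Ico le_rfl (show width T k ≤ m by omega) hx)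

theorem rigidOn_columnMap (T : ℕ) (S : Finset ℕ) (θ : Bool → Bool × ℕ) (h : Bool) (hj : j ≤ k)
    (hp : p ∈ tiles k j) : RigidOn (columnMap T k S θ h j) (zone (T + 1) k j p) := by
  have htop : RigidOn (place (width T k) (θ h)) (core (T + 1) k k 0 0) := by
    rw [coe_core_top]
    exact rigidOn_place _ _
  exact htop.comp (rigidOn_later (T + 1) S hj hp) fun x hx =>
    later_mem_core_top hj (core_subset_core_top hj hp hx)

theorem position_injective (T k m : ℕ) (S : Finset ℕ) (θ : Bool → Bool × ℕ) :
    Function.Injective (position T k m S θ) := by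
  intro u v huv
  simp only [position, Prod.mk.injEq] at huv
  obtain ⟨hrow, hcol⟩ := huv
  rw [hrow] at hcol
  exact coord_injective m (Prod.ext hrow ((columnMap T k S θ _ 0).injective hcol))

theorem position_mem_square (hθ : θ ∈ placements T k) (hm : 2 * width T k ≤ m)
    (u : Fin (m ^ 2)) : position T k m S θ u ∈ square m :=
  have hu := coord_mem_square m u
  ⟨hu.1, columnMap_mem_Ico hθ hm hu.2⟩

theorem exists_coord_eq (hm : width T k ≤ m) (hj : j ≤ k) (hp : p ∈ tiles k j) (h : Bool)
    (hz : z ∈ slot (T + 1) k j p) : ∃ u : Fin (m ^ 2), coord m u = (mainRow T h, z) := by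
  have hz' : z ∈ (core (T + 1) k k 0 0 : Set ℤ) := core_subset_core_top hj hp hz
  rw [coe_core_top] at hz'
  have hmem : (mainRow T h, z) ∈ square m :=
    ⟨mainRow_mem_Ico h hm, hz'.1, hz'.2.trans_le (by exact_mod_cast hm)⟩
  rwa [← range_eq_square (coord_injective m) (coord_mem_square m)] at hmem

theorem nbhd_position_subset (hj : j ≤ k) (hp : p ∈ tiles k j) {u : Fin (m ^ 2)}
    (hrow : (coord m u).1 = mainRow T h) (hcol : (coord m u).2 ∈ slot (T + 1) k j p) :
    nbhd (planeGrid.comap (position T k m S θ)) (T + 1) u ⊆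
      {v | halfOf T (coord m v).1 = h ∧
        arrange (T + 1) k S j (coord m v).2 ∈ zone (T + 1) k j p} := by
  intro v hv
  obtain ⟨hvrow, hvcol⟩ := abs_sub_le_of_mem_nbhd_comap hv
  simp only [position, hrow] at hvrow hvcol
  have hhalf := halfOf_eq_of_abs_sub_le (by exact_mod_cast hvrow)
  refine ⟨hhalf, ?_⟩
  rw [hhalf, halfOf_mainRow, ← columnMap_arrange (j := j),
    ← columnMap_arrange (j := j)] at hvcol
  have hz : arrange (T + 1) k S j (coord m u).2 ∈ slot (T + 1) k j p :=
    (arrange_mem_core_iff le_rfl le_rfl).2 hcol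
  rw [slot, core, Finset.mem_Ico, Nat.sub_add_comm hj] at hz
  have hrigid := rigidOn_columnMap T S θ h hj hp
  rw [zone, core, Finset.coe_Ico] at hrigid
  rw [zone, core, Finset.mem_Ico]
  refine hrigid.mem_Ico_of_abs_sub_le (Equiv.injective _) ?_ hvcol
  push_cast at hz ⊢
  constructor <;> linarith

theorem agreeNear_position (hj : j ≤ k) (hS : ∀ i < j, i ∈ S ↔ i ∈ S') {u : Fin (m ^ 2)}
    (hu : u ∈ early T k m j) :
    AgreeNear (planeGrid.comap (position T k m S θ)) (planeGrid.comap (position T k m S' θ'))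
      T u := by
  obtain ⟨h, p, hp, hrow, hcol⟩ := hu
  have harrange := arrange_congr (g := T + 1) (k := k) hS
  refine agreeNear_of_restrict_eq (nbhd_position_subset hj hp hrow hcol) ?_ ?_
  · rw [harrange]
    exact nbhd_position_subset hj hp hrow hcol
  · ext v w
    refine and_congr_left ?_
    rintro ⟨⟨hv, hvcol⟩, hw, hwcol⟩
    simp only [SimpleGraph.comap_adj, planeGrid_adj, position, hv, hw]
    rw [← columnMap_arrange (j := j), ← columnMap_arrange (j := j),
      (rigidOn_columnMap T S θ h hj hp).abs_sub hvcol hwcol,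
      ← columnMap_arrange (S := S') (j := j), ← columnMap_arrange (S := S') (j := j), ← harrange,
      (rigidOn_columnMap T S' θ' h hj hp).abs_sub hvcol hwcol]

end Adversary

section Response

/-- The colours of the main row in half `h`, written in the arrangement after the levels below
`j`, if `c S θ` is the colouring of the plane for the reflections `S` and the placements `θ`. -/
noncomputable def rowColor {T k : ℕ} (c : Finset ℕ → (Bool → Bool × ℕ) → ℤ × ℤ → Fin 3)
    (S : Finset ℕ) (θ : Bool → Bool × ℕ) (h : Bool) (j : ℕ) (z : ℤ) : Fin 3 :=
  c S θ (mainRow T h, columnMap T k S θ h j z)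

/-- An algorithm that never fails, seen by the adversary: `color S θ` is the colouring of the
`m × m` grid, in terms of the final positions, for the reflections `S` and the placements `θ`. The
slots of level `j` are coloured before the reflections of level `j` become visible. -/
structure ProperResponse (T k m : ℕ) where
  color : Finset ℕ → (Bool → Bool × ℕ) → ℤ × ℤ → Fin 3
  isProper : ∀ S, ∀ θ ∈ placements T k, IsProper (restrict planeGrid (square m)) (color S θ)
  rowColor_congr : ∀ j ≤ k, ∀ S S', (∀ i < j, i ∈ S ↔ i ∈ S') →
    ∀ θ θ' h, ∀ p ∈ tiles k j, ∀ z ∈ slot (T + 1) k j p,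
      rowColor (T := T) (k := k) color S θ h j z = rowColor (T := T) (k := k) color S' θ' h j z

/-- The placements that do not move any column. -/
def basePlacement : Bool → Bool × ℕ := fun _ => (false, 0)

theorem basePlacement_mem (T k : ℕ) : basePlacement ∈ placements T k :=
  mem_placements.2 fun _ => Nat.zero_le _

namespace ProperResponse

variable {T k m : ℕ} (R : ProperResponse T k m)

/-- The colours of the main row in half `h` without final placement, see `rowColor`. -/
noncomputable abbrev baseColor (S : Finset ℕ) (h : Bool) (j : ℕ) : ℤ → Fin 3 :=
  rowColor (T := T) (k := k) R.color S basePlacement h j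

/-- The sum of `2 ^ (-spread)` over all slots of level `j` in the main row of the upper half. -/
noncomputable def weight (S : Finset ℕ) (j : ℕ) : ℝ :=
  ∑ p ∈ tiles k j, (1 / 2) ^ spread (R.baseColor S true j) (slot (T + 1) k j p)

variable {R} {S S' : Finset ℕ} {θ : Bool → Bool × ℕ} {h : Bool} {j : ℕ} {p z : ℤ}

theorem columnMap_slot_mem_Ico (hm : 2 * width T k ≤ m) (hθ : θ ∈ placements T k) (hj : j ≤ k)
    (hp : p ∈ tiles k j) (hz : z ∈ slot (T + 1) k j p) :
    columnMap T k S θ h j z ∈ Set.Ico (0 : ℤ) m := by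
  obtain ⟨x, rfl⟩ := (arrange (T + 1) k S j).surjective z
  rw [arrange_mem_core_iff le_rfl le_rfl] at hz
  have hx : x ∈ (core (T + 1) k k 0 0 : Set ℤ) := core_subset_core_top hj hp hz
  rw [coe_core_top] at hx
  rw [columnMap_arrange]
  have hwidth : width T k ≤ m := by omega
  exact columnMap_mem_Ico hθ hm ⟨hx.1, hx.2.trans_le (by exact_mod_cast hwidth)⟩

theorem baseColor_ne_succ (hm : 2 * width T k ≤ m) (hj : j ≤ k) (hp : p ∈ tiles k j)
    (hz : z ∈ slot (T + 1) k j p) (hz' : z + 1 ∈ slot (T + 1) k j p) :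
    R.baseColor S h j z ≠ R.baseColor S h j (z + 1) := by
  have hrow := mainRow_mem_Ico (T := T) (k := k) (m := m) h (by omega)
  refine R.isProper S _ (basePlacement_mem T k) _ _
    ⟨?_, ⟨hrow, columnMap_slot_mem_Ico hm (basePlacement_mem T k) hj hp hz⟩,
      hrow, columnMap_slot_mem_Ico hm (basePlacement_mem T k) hj hp hz'⟩
  rw [planeGrid_adj, (rigidOn_columnMap T S basePlacement h hj hp).abs_sub
    (slot_subset_zone j p hz) (slot_subset_zone j p hz')]
  simp

theorem heightPreserving_flip (hm : 2 * width T k ≤ m) (hj : j < k)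
    (hS : ∀ i < j, i ∈ S ↔ i ∈ S') (hp : p ∈ tiles k j) :
    HeightPreserving (R.baseColor S h j) (R.baseColor S' h (j + 1)) (flip (T + 1) k S' j)
      (slot (T + 1) k j p) (slot (T + 1) k (j + 1) (p / 2)) := by
  have hrigid := (rigidOn_flip (T + 1) S' hp).mono (slot_subset_zone j p)
  refine hrigid.heightPreserving (fun z hz => ?_)
    (fun z hz hz' => baseColor_ne_succ hm hj.le hp hz hz') fun z hz => ?_
  · exact flip_mem_core j.le_succ (by omega) (slot_subset_slot j p hz)
  · rw [baseColor, rowColor, columnMap_flip]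
    exact (R.rowColor_congr j hj.le S S' hS _ _ h p hp z hz).symm

theorem weight_add_weight_insert_le (hm : 2 * width T k ≤ m) (hj : j < k) (hjS : j ∉ S) :
    R.weight S (j + 1) + R.weight (insert j S) (j + 1) ≤ 3 / 4 * R.weight S j := by
  rw [weight, weight, weight, sum_tiles hj, ← Finset.sum_add_distrib, Finset.mul_sum]
  refine Finset.sum_le_sum fun q hq => ?_
  have hpow : (2 : ℤ) ^ (k - j) = 2 ^ (k - (j + 1)) * 2 := by rw [← pow_succ]; congr 1; omega
  rw [tiles, Finset.mem_Ico] at hq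
  have hleft : 2 * q ∈ tiles k j := by rw [tiles, Finset.mem_Ico, hpow]; omega
  have hright : 2 * q + 1 ∈ tiles k j := by rw [tiles, Finset.mem_Ico, hpow]; omega
  have embed {S' : Finset ℕ} (hS' : ∀ i < j, i ∈ S ↔ i ∈ S') {p : ℤ} (hp : p ∈ tiles k j)
      (hpq : p / 2 = q) := hpq ▸ heightPreserving_flip (R := R) (h := true) hm hj hS' hp
  have hinsert : ∀ i < j, i ∈ S ↔ i ∈ insert j S := fun i hi => by simp [hi.ne]
  refine half_pow_spread_add_le (core_nonempty (by omega) _) (core_nonempty (by omega) _)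
    (embed (fun _ _ => Iff.rfl) hleft (by omega)) (embed (fun _ _ => Iff.rfl) hright (by omega))
    (embed hinsert hleft (by omega)) (embed hinsert hright (by omega))
    (fun z hz => ?_) fun z hz => ?_
  · rw [flip_of_even (even_two_mul q) (slot_subset_zone _ _ hz), flip_of_notMem hjS]
    simp
  · rw [flip_of_odd (Finset.mem_insert_self j S) hright (odd_two_mul_add_one q)
      (slot_subset_zone _ _ hz), flip_of_notMem hjS, Equiv.Perm.one_apply, sub_sub, sub_sub]
    have heven := (even_tile (g := T + 1) (k := k) j).natCast (α := ℤ)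
    rw [show 1 + (z + z) = 2 * z + 1 by ring]
    exact (heven.mul_left _).sub_odd (odd_two_mul_add_one z)

theorem exists_weight_le (R : ProperResponse T k m) (hm : 2 * width T k ≤ m) (hj : j ≤ k) :
    ∃ S ⊆ Finset.range j, R.weight S j ≤ (3 / 8) ^ j * 2 ^ k := by
  induction j with
  | zero =>
    refine ⟨∅, subset_rfl, ?_⟩
    calc R.weight ∅ 0 ≤ ∑ _p ∈ tiles k 0, (1 : ℝ) :=
          Finset.sum_le_sum fun p _ => pow_le_one₀ (by norm_num) (by norm_num)
      _ = (3 / 8) ^ 0 * 2 ^ k := by simp [tiles, Int.toNat_pow_of_nonneg]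
  | succ j ih =>
    obtain ⟨S, hS, hweight⟩ := ih (by omega)
    have hsum := weight_add_weight_insert_le (R := R) hm hj
      fun h => absurd (Finset.mem_range.1 (hS h)) (lt_irrefl j)
    rw [pow_succ, Finset.range_add_one]
    rcases le_total (R.weight S (j + 1)) (R.weight (insert j S) (j + 1)) with h | h
    · exact ⟨S, hS.trans (Finset.subset_insert _ _), by linarith⟩
    · exact ⟨insert j S, Finset.insert_subset_insert _ hS, by linarith⟩

theorem exists_le_spread (R : ProperResponse T k m) (hm : 2 * width T k ≤ m) {r : ℕ}
    (hk : k = 3 * r) :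
    ∃ S, r ≤ spread (R.baseColor S true k) (slot (T + 1) k k 0) := by
  obtain ⟨S, -, hS⟩ := R.exists_weight_le hm le_rfl
  refine ⟨S, (pow_le_pow_iff_right_of_lt_one₀ (a := (1 / 2 : ℝ)) (by norm_num) (by norm_num)).1 ?_⟩
  calc (1 / 2 : ℝ) ^ spread (R.baseColor S true k) (slot (T + 1) k k 0)
      = R.weight S k := by rw [weight, tiles_self, Finset.sum_singleton]
    _ ≤ (3 / 8) ^ k * 2 ^ k := hS
    _ = (27 / 64) ^ r := by rw [← mul_pow, hk, pow_mul]; norm_num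
    _ ≤ (1 / 2) ^ r := pow_le_pow_left₀ (by norm_num) (by norm_num) r

theorem heightPreserving_place (hm : 2 * width T k ≤ m) (hθ : θ ∈ placements T k) :
    HeightPreserving (R.baseColor S h k) (fun z => R.color S θ (mainRow T h, z))
      (place (width T k) (θ h)) (slot (T + 1) k k 0) (Finset.Ico 0 m) := by
  have hzero : (0 : ℤ) ∈ tiles k k := by simp [tiles_self]
  have hmove (θ : Bool → Bool × ℕ) : columnMap T k S θ h k = place (width T k) (θ h) := by
    rw [columnMap, later_self, mul_one]
  have hrigid := (rigidOn_columnMap T S θ h le_rfl hzero).mono (slot_subset_zone k 0)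
  rw [hmove] at hrigid
  refine hrigid.heightPreserving (fun z hz => ?_)
    (fun z hz hz' => baseColor_ne_succ hm le_rfl hzero hz hz') fun z hz => ?_
  · rw [Finset.mem_Ico, ← hmove]
    exact columnMap_slot_mem_Ico hm hθ le_rfl hzero hz
  · rw [← hmove]
    exact R.rowColor_congr k le_rfl S S (fun _ _ => Iff.rfl) θ _ h 0 hzero z hz

-- The placements put the two segments above each other; the rows between them give the bound.
theorem abs_height_sub_le (hm : 2 * width T k ≤ m) (hθ : θ ∈ placements T k) {u v u' v' : ℤ}
    (hu : u ∈ slot (T + 1) k k 0) (hv : v ∈ slot (T + 1) k k 0)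
    (hu' : u' ∈ slot (T + 1) k k 0) (hv' : v' ∈ slot (T + 1) k k 0)
    (huu' : place (width T k) (θ true) u = place (width T k) (θ false) u')
    (hvv' : place (width T k) (θ true) v = place (width T k) (θ false) v') :
    |(height (R.baseColor S false k) v' - height (R.baseColor S false k) u') -
      (height (R.baseColor S true k) v - height (R.baseColor S true k) u)| ≤ 4 * T + 6 := by
  have hupper := heightPreserving_place (R := R) (S := S) (h := true) hm hθ
  have hlower := heightPreserving_place (R := R) (S := S) (h := false) hm hθ
  rw [← hupper.sub_eq u hu v hv, ← hlower.sub_eq u' hu' v' hv', ← huu', ← hvv']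
  have hwidth := two_mul_add_three_lt_width T k
  have hrows := abs_height_row_sub_le (R.isProper S θ hθ) (y := 0) (n := 2 * T + 3) le_rfl
    (by push_cast; omega) (Finset.mem_Ico.1 (hupper.mapsTo u hu))
    (Finset.mem_Ico.1 (hupper.mapsTo v hv))
  simp only [mainRow, if_true, Bool.false_eq_true, if_false]
  push_cast [zero_add] at hrows
  linarith

end ProperResponse

theorem isEmpty_properResponse {T k m : ℕ} (hk : k = 3 * (4 * T + 7))
    (hm : 2 * width T k ≤ m) : IsEmpty (ProperResponse T k m) := by
  refine ⟨fun R => ?_⟩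
  obtain ⟨S, hS⟩ := R.exists_le_spread hm hk
  have hne : (slot (T + 1) k k 0).Nonempty := core_nonempty (by omega) 0
  obtain ⟨u, hu, v, hv, huv⟩ := exists_spread_eq (R.baseColor S true k) hne
  have mem_Ico {z : ℤ} (hz : z ∈ slot (T + 1) k k 0) : z ∈ Set.Ico (0 : ℤ) (width T k) := by
    rw [← coe_core_top]
    exact core_subset_core_top le_rfl (by simp [tiles_self]) hz
  have hu₀ := mem_Ico hu
  have hv₀ := mem_Ico hv
  have htranslate := ProperResponse.abs_height_sub_le (R := R) (S := S) hm
    (basePlacement_mem T k) hu hv hu hv rfl rfl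
  -- The translation of one row and the reflection of the other put `u` above `v` and vice versa.
  let d : ℤ := width T k - 1 - u - v
  let θ : Bool → Bool × ℕ := fun h => if h then (false, d.toNat) else (true, (-d).toNat)
  have hθ : θ ∈ placements T k := mem_placements.2 fun h => by
    cases h <;> simp only [θ, d] <;> grind
  have halign {x y : ℤ} (hx : x ∈ Set.Ico (0 : ℤ) (width T k))
      (hy : y ∈ Set.Ico (0 : ℤ) (width T k)) (hxy : x + y = u + v) :
      place (width T k) (θ true) x = place (width T k) (θ false) y := by
    simp only [place_of_mem_Ico _ hx, place_of_mem_Ico _ hy, θ, d, Bool.false_eq_true, if_true,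
      if_false]
    omega
  have hreflect := ProperResponse.abs_height_sub_le (R := R) (S := S) hm hθ hu hv hv hu
    (halign hu₀ hv₀ rfl) (halign hv₀ hu₀ (add_comm v u))
  rw [abs_le] at htranslate hreflect
  omega

end Response

/-! ### The lower bound -/

section LowerBound

variable {T k m : ℕ}

theorem position_congr {S S' : Finset ℕ} (θ : Bool → Bool × ℕ) (h : ∀ i < k, i ∈ S ↔ i ∈ S') :
    position T k m S θ = position T k m S' θ := by
  have hcol (h' : Bool) (x : ℤ) : columnMap T k S θ h' 0 x = columnMap T k S' θ h' 0 x := by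
    rw [← columnMap_arrange (j := k), ← columnMap_arrange (j := k), columnMap, columnMap,
      later_self, later_self, arrange_congr h]
  funext u
  rw [position, position, hcol]

theorem nonempty_properResponse (hm : 2 * width T k ≤ m) {σ : Equiv.Perm (Fin (m ^ 2))}
    (hσ : ∀ j, IsLowerSet (σ ⁻¹' early T k m j)) (A : DetAlgorithm (m ^ 2) (Fin 3))
    (hA : ∀ S, ∀ θ ∈ placements T k, IsProper (planeGrid.comap (position T k m S θ))
      (output A (planeGrid.comap (position T k m S θ)) T σ)) :
    Nonempty (ProperResponse T k m) := by
  refine ⟨fun S θ => Function.extend (position T k m S θ)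
    (output A (planeGrid.comap (position T k m S θ)) T σ) fun _ => 0, fun S θ hθ => ?_, ?_⟩
  · rw [← range_eq_square (position_injective T k m S θ) (position_mem_square hθ hm)]
    exact isProper_restrict_range _ (position_injective T k m S θ) (hA S θ hθ)
  · intro j hj S S' hS θ θ' h p hp z hz
    obtain ⟨x, rfl⟩ := (arrange (T + 1) k S j).surjective z
    rw [arrange_mem_core_iff le_rfl le_rfl] at hz
    obtain ⟨u, hu⟩ := exists_coord_eq (m := m) (by omega) hj hp h hz
    have hposition (S : Finset ℕ) (θ : Bool → Bool × ℕ) :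
        (mainRow T h, columnMap T k S θ h j (arrange (T + 1) k S j x)) =
          position T k m S θ u := by
      rw [position, hu, halfOf_mainRow, columnMap_arrange]
    have hearly : u ∈ early T k m j := ⟨h, p, hp, by rw [hu], by rwa [hu]⟩
    rw [rowColor, rowColor, hposition, arrange_congr hS, hposition,
      (position_injective T k m S θ).extend_apply, (position_injective T k m S' θ').extend_apply]
    exact output_congr A (hσ j) (fun v hv => agreeNear_position hj hS hv) hearly

theorem exists_perm_forall_exists_not_isProper (hk : k = 3 * (4 * T + 7))
    (hm : 2 * width T k ≤ m) :
    ∃ σ : Equiv.Perm (Fin (m ^ 2)), ∀ A : DetAlgorithm (m ^ 2) (Fin 3),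
      ∃ q ∈ (Finset.range k).powerset ×ˢ placements T k,
        ¬ IsProper (planeGrid.comap (position T k m q.1 q.2))
          (output A (planeGrid.comap (position T k m q.1 q.2)) T σ) := by
  obtain ⟨σ, hσ⟩ := exists_perm_isLowerSet (early_monotone T k m)
  refine ⟨σ, fun A => ?_⟩
  by_contra! hA
  refine not_nonempty_iff.2 (isEmpty_properResponse hk hm)
    (nonempty_properResponse hm hσ A fun S θ hθ => ?_)
  rw [position_congr (S' := S ∩ Finset.range k) θ fun i hi => by simp [hi]]
  exact hA (S ∩ Finset.range k, θ) (Finset.mk_mem_product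
    (Finset.mem_powerset.2 Finset.inter_subset_right) hθ)

theorem not_colors_of_forall_exists {n : ℕ} {C ι : Type*} {F : Set (SimpleGraph (Fin n))}
    {s : Finset ι} {G : ι → SimpleGraph (Fin n)} {σ : ι → Equiv.Perm (Fin n)}
    (hG : ∀ i ∈ s, G i ∈ F) (hcard : s.card < n)
    (h : ∀ A : DetAlgorithm n C, ∃ i ∈ s, ¬ IsProper (G i) (output A (G i) T (σ i)))
    (μ : RandAlgorithm n C) : ¬ Colors F T μ := by
  intro hμ
  let fails (i : ι) : Set (DetAlgorithm n C) := {A | ¬ IsProper (G i) (output A (G i) T (σ i))}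
  have hcover : ⋃ i ∈ s, fails i = Set.univ := Set.eq_univ_of_forall fun A => by
    simpa [fails] using h A
  have hle : (1 : ENNReal) ≤ s.card / n :=
    calc (1 : ENNReal) = μ.toOuterMeasure (⋃ i ∈ s, fails i) := by
          rw [hcover, (μ.toOuterMeasure_apply_eq_one_iff _).2 (Set.subset_univ _)]
      _ ≤ ∑ i ∈ s, μ.toOuterMeasure (fails i) := MeasureTheory.measure_biUnion_finset_le s fails
      _ ≤ ∑ _i ∈ s, 1 / (n : ENNReal) := Finset.sum_le_sum fun i hi => hμ (G i) (hG i hi) (σ i)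
      _ = s.card / n := by rw [Finset.sum_const, nsmul_eq_mul, mul_one_div]
  have hlt : (s.card / n : ENNReal) < 1 :=
    ENNReal.div_lt_of_lt_mul (by rw [one_mul]; exact_mod_cast hcard)
  exact hlt.not_ge hle

theorem card_placements (T k : ℕ) : (placements T k).card = (2 * (width T k + 1)) ^ 2 := by
  simp [placements]

theorem not_colors_squareGrids_of_card_lt (hk : k = 3 * (4 * T + 7)) (hm : 2 * width T k ≤ m)
    (hcard : 2 ^ k * (2 * (width T k + 1)) ^ 2 < m ^ 2) (μ : RandAlgorithm (m ^ 2) (Fin 3)) :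
    ¬ Colors (squareGrids (m ^ 2)) T μ := by
  obtain ⟨σ, hσ⟩ := exists_perm_forall_exists_not_isProper hk hm
  refine not_colors_of_forall_exists (fun q hq => ?_) ?_ hσ μ
  · exact comap_planeGrid_mem_squareGrids (position_injective T k m q.1 q.2)
      (position_mem_square (Finset.mem_product.1 hq).2 hm)
  · rwa [Finset.card_product, Finset.card_powerset, Finset.card_range, card_placements]

theorem width_le (hk : k = 3 * (4 * T + 7)) : width T k ≤ 2 ^ (14 * T + 27) :=
  calc width T k = 2 ^ k * (2 * (k + 1) * (T + 1) + 2) := rfl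
    _ ≤ 2 ^ k * (64 * (T + 1) ^ 2) := by gcongr; subst hk; nlinarith
    _ ≤ 2 ^ k * (64 * (2 ^ T) ^ 2) := by gcongr; exact Nat.lt_two_pow_self
    _ = 2 ^ (14 * T + 27) := by subst hk; ring

theorem not_colors_squareGrids (hm : 2 ^ (50 * (T + 1)) ≤ m) (μ : RandAlgorithm (m ^ 2) (Fin 3)) :
    ¬ Colors (squareGrids (m ^ 2)) T μ := by
  obtain ⟨k, hk⟩ : ∃ k, k = 3 * (4 * T + 7) := ⟨_, rfl⟩
  have hwidth := width_le hk
  refine not_colors_squareGrids_of_card_lt hk ?_ ?_ μ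
  · calc 2 * width T k ≤ 2 * 2 ^ (14 * T + 27) := by gcongr
      _ = 2 ^ (14 * T + 28) := by ring
      _ ≤ 2 ^ (50 * (T + 1)) := Nat.pow_le_pow_right two_pos (by omega)
      _ ≤ m := hm
  · calc 2 ^ k * (2 * (width T k + 1)) ^ 2
        ≤ 2 ^ k * (2 * (2 ^ (14 * T + 27) + 2 ^ (14 * T + 27))) ^ 2 := by
          gcongr
          exact Nat.one_le_two_pow
      _ = 2 ^ (40 * T + 79) := by subst hk; ring
      _ < 2 ^ (100 * (T + 1)) := Nat.pow_lt_pow_right one_lt_two (by omega)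
      _ = (2 ^ (50 * (T + 1))) ^ 2 := by ring
      _ ≤ m ^ 2 := by gcongr

theorem log_le_of_colors_squareGrids (hm : 2 ^ 100 ≤ m) {μ : RandAlgorithm (m ^ 2) (Fin 3)}
    (h : Colors (squareGrids (m ^ 2)) T μ) : 1 / 200 * Real.log ((m ^ 2 : ℕ) : ℝ) ≤ T := by
  have hlt : m < 2 ^ (50 * (T + 1)) := not_le.1 fun hm' => not_colors_squareGrids hm' μ h
  have hm₀ : 0 < m := hm.trans_lt' (by norm_num)
  have hT : 100 < 50 * (T + 1) := (Nat.pow_lt_pow_iff_right one_lt_two).1 (hm.trans_lt hlt)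
  have hT' : (1 : ℝ) ≤ T := by exact_mod_cast (show 1 ≤ T by omega)
  have hlog : Real.log m ≤ 50 * (T + 1) :=
    calc Real.log m ≤ Real.log (2 ^ (50 * (T + 1))) :=
          Real.log_le_log (Nat.cast_pos.2 hm₀) (by exact_mod_cast hlt.le)
      _ = 50 * (T + 1) * Real.log 2 := by rw [Real.log_pow]; push_cast; rfl
      _ ≤ 50 * (T + 1) :=
          mul_le_of_le_one_right (by linarith) (by linarith [Real.log_two_lt_d9])
  rw [Nat.cast_pow, Real.log_pow]
  push_cast
  linarith

theorem Colors.mono {n : ℕ} {C : Type*} {F F' : Set (SimpleGraph (Fin n))}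
    {μ : RandAlgorithm n C} (h : Colors F' T μ) (hF : F ⊆ F') : Colors F T μ :=
  fun G hG σ => h G (hF hG) σ

theorem not_eventually_colors_bipartiteGraphs {T : ℕ → ℕ}
    (hT : (fun n => (T n : ℝ)) =o[Filter.atTop] fun n : ℕ => Real.log n)
    (μ : (n : ℕ) → RandAlgorithm n (Fin 3)) :
    ¬ ∀ᶠ n in Filter.atTop, Colors (bipartiteGraphs n) (T n) (μ n) := by
  intro hμ
  have hsq : Filter.Tendsto (fun m : ℕ => m ^ 2) Filter.atTop Filter.atTop :=
    Filter.tendsto_pow_atTop two_ne_zero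
  obtain ⟨m, ⟨hsmall, hcolors⟩, hm⟩ :=
    ((hsq.eventually ((hT.bound (show (0 : ℝ) < 1 / 400 by norm_num)).and hμ)).and
      (Filter.eventually_ge_atTop (2 ^ 100))).exists
  have hlarge :=
    log_le_of_colors_squareGrids hm (hcolors.mono (squareGrids_subset_bipartiteGraphs (m ^ 2)))
  have hpos : 0 < Real.log ((m ^ 2 : ℕ) : ℝ) :=
    Real.log_pos (by exact_mod_cast Nat.one_lt_pow two_ne_zero (show 1 < m by omega))
  rw [Real.norm_of_nonneg (Nat.cast_nonneg _), Real.norm_of_nonneg hpos.le] at hsmall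
  linarith

end LowerBound

end OnlineLocal

theorem mainTheorem9 :
    (∃ c : ℝ, 0 < c ∧ ∃ m₀ : ℕ, ∀ m : ℕ, m₀ ≤ m →
      ∀ (T : ℕ) (μ : OnlineLocal.RandAlgorithm (m ^ 2) (Fin 3)),
        OnlineLocal.Colors (OnlineLocal.squareGrids (m ^ 2)) T μ →
          c * Real.log ((m ^ 2 : ℕ) : ℝ) ≤ (T : ℝ)) ∧
    (∀ T : ℕ → ℕ,
      Asymptotics.IsLittleO Filter.atTop (fun n : ℕ => (T n : ℝ)) (fun n : ℕ => Real.log (n : ℝ)) →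
        ¬ ∃ μ : (n : ℕ) → OnlineLocal.RandAlgorithm n (Fin 3),
          ∀ᶠ n in Filter.atTop, OnlineLocal.Colors (OnlineLocal.bipartiteGraphs n) (T n) (μ n)) :=
  ⟨⟨1 / 200, by norm_num, 2 ^ 100, fun _ hm _ _ h => OnlineLocal.log_le_of_colors_squareGrids hm h⟩,
    fun _ hT ⟨μ, hμ⟩ => OnlineLocal.not_eventually_colors_bipartiteGraphs hT μ hμ⟩
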